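/- For $p,q\in\{0,1\}^d$ let $D(p,q)$ be their Hamming distance, for $S\subseteq\{0,1\}^d$ let $D(q,S)=\min_{p\in S}D(q,p)$, and let $B(\rho,d)$ be the number of points in a Hamming ball of radius $\rho$ in $\{0,1\}^d$. Let $r\ge 0$ and $c\ge 1$ be real. A (randomized) $(r,c,\varepsilon)$-distance sensitive approximate membership filter with average error $\varepsilon$ for $n$-point sets stores, for each $S\subseteq\{0,1\}^d$ with $|S|=n$, a bit string depending on $S$ and on its random choices, and answers a query $q\in\{0,1\}^d$ by `Yes' or `No' from the stored string, the random choices and $q$ alone (the random choices are not counted as space), such that for every such $S$: (i) every $q$ with $D(q,S)\le r$ is always answered `Yes' (no false negatives); (ii) if $q$ is chosen uniformly at random from $Q_{\mathrm{far}}=\{x\in\{0,1\}^d : D(x,S)>cr\}$, then the answer is `No' with probability at least $1-\varepsilon$, over the choice of $q$ and the random choices of the filter. **Theorem.** There is an absolute constant $K>0$ such that the following holds for all $d$, $n$, $r\ge 0$, $c\ge 1$ and $\varepsilon$ with $$\frac{n\,B(cr,d)}{2^d}<\varepsilon<\frac14 .$$ Every $(r,c,\varepsilon)$-distance sensitive approximate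 membership filter with average error $\varepsilon$ for $n$-point subsets of $\{0,1\}^d$ uses, in the worst case over $S$ and its random choices, at least $$K\,n\left(\frac{r^2}{d}+\log_2\frac1\varepsilon\right)$$ bits; that is, it uses $\Omega\!\left(n\left(\frac{r^2}{d}+\log\frac1\varepsilon\right)\right)$ bits in the worst case. -/

import Mathlib

open MeasureTheory

/-- The Hamming cube `{0,1}^d`. -/
abbrev Cube (d : ℕ) : Type := Fin d → Bool

open Classical in
/-- The Hamming ball of (real) radius `ρ` around `q` in `{0,1}^d`. -/
noncomputable def hammingBall {d : ℕ} (q : Cube d) (ρ : ℝ) : Finset (Cube d) :=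
  Finset.univ.filter fun p => (hammingDist p q : ℝ) ≤ ρ

/-- `B(ρ, d)`: the size of a Hamming ball of radius `ρ` in `{0,1}^d`; it does not depend on the
centre, here the all-zero vector. -/
noncomputable def ballSize (ρ : ℝ) (d : ℕ) : ℕ :=
  (hammingBall (fun _ : Fin d => false) ρ).card

open Classical in
/-- `Q_near`: the points `x` with `D(x, S) ≤ r`, where `D(x, S)` is the minimum of the distances
from `x` to the points of `S`. -/
noncomputable def Qnear {d : ℕ} (S : Finset (Cube d)) (r : ℝ) : Finset (Cube d) :=
  Finset.univ.filter fun x => ∃ p ∈ S, (hammingDist x p : ℝ) ≤ r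

open Classical in
/-- `Q_far`: the points `x` with `D(x, S) > c r`. -/
noncomputable def Qfar {d : ℕ} (S : Finset (Cube d)) (r c : ℝ) : Finset (Cube d) :=
  Finset.univ.filter fun x => ∀ p ∈ S, c * r < (hammingDist x p : ℝ)

/-- A randomized data structure for subsets of `{0,1}^d`, with random choices `ω : Ω`.
`encode S ω` is the string of bits stored for `S`. The query algorithm sees the stored bits, the
random choices and the query point, but not `S`; the answer `true` is 'Yes', `false` is 'No'.
The random choices are shared by both algorithms and are not counted as space; private coins of
either algorithm are the case where it alone looks at a part of `ω`. -/
structure MembershipFilter (d : ℕ) (Ω : Type*) where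
  /-- the stored memory representation -/
  encode : Finset (Cube d) → Ω → List Bool
  /-- the query algorithm -/
  query : List Bool → Ω → Cube d → Bool

namespace MembershipFilter

variable {d : ℕ} {Ω : Type*}

/-- The answer to the query `q` when the stored set is `S` and the random choices are `ω`. -/
def answer (F : MembershipFilter d Ω) (S : Finset (Cube d)) (ω : Ω) (q : Cube d) : Bool :=
  F.query (F.encode S ω) ω q

/-- `F` is an `(r, c, ε)`-distance sensitive approximate membership filter for `S` with average
error `ε`: there are no false negatives, and a query point drawn uniformly from `Q_far`
(independently of the random choices of the filter) is answered 'No' with probability at least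
`1 - ε`. -/
structure HasAverageError [MeasurableSpace Ω] (F : MembershipFilter d Ω) (μ : Measure Ω)
    (r c ε : ℝ) (S : Finset (Cube d)) : Prop where
  measurableSet_no : ∀ q, MeasurableSet {ω | F.answer S ω q = false}
  yes_of_near : ∀ q ∈ Qnear S r, ∀ ω, F.answer S ω q = true
  no_of_far : (Qfar S r c).Nonempty →
    1 - ε ≤ (∑ q ∈ Qfar S r c, μ.real {ω | F.answer S ω q = false}) / ((Qfar S r c).card : ℝ)

end MembershipFilter

/-! Fix the random choices so that at least half of all `n`-sets answer No on a fraction at least `1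
- 2ε` of their far points. For a stored string `m`, let `Z m` be its No-set and `A m` the points
farther than `r` from `Z m`. Having no false negatives forces `S ⊆ A m` for every `S` stored as `m`.
The far points nearly fill the cube, so `Z m` has density at least `1 - 3ε`; hence `A m` has density
at most `3ε` by disjointness, and at most `4 exp(-r²/d)` by concentration of measure. If every `A m`
has density at most `θ`, one string serves at most a fraction `θ ^ n` of all `n`-sets, so about `n
log (1/θ)` bits are needed. The two choices of `θ` yield the two terms of the bound. -/

/-! ### Concentration of measure on the cube -/

open Finset in
/-- A two-function inequality on the cube, from which concentration of measure follows. -/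
theorem sum_mul_sum_le_of_mul_le_exp_hammingDist (t : ℝ) :
    ∀ (d : ℕ) (C : ℝ) (f g : Cube d → ℝ), 0 < C → 0 ≤ f → 0 ≤ g →
      (∀ x y, f x * g y ≤ C * Real.exp (t * hammingDist x y)) →
      (∑ x, f x) * (∑ x, g x) ≤ C * (2 + 2 * Real.cosh t) ^ d := by
  intro d
  induction d with
  | zero =>
    intro C f g _ _ _ h
    have := h isEmptyElim isEmptyElim
    simp only [hammingDist_self, Nat.cast_zero, mul_zero, Real.exp_zero, mul_one] at this
    rw [Fintype.sum_subsingleton f isEmptyElim, Fintype.sum_subsingleton g isEmptyElim]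
    simpa only [pow_zero, mul_one] using this
  | succ d ih =>
    intro C f g hC hf hg h
    have hsplit : ∀ u : Cube (d + 1) → ℝ,
        ∑ x, u x = ∑ x : Cube d, u (Fin.cons false x) + ∑ x : Cube d, u (Fin.cons true x) := by
      intro u
      rw [← (Fin.consEquiv fun _ : Fin (d + 1) => Bool).sum_comp u, Fintype.sum_prod_type]
      simp [Fin.consEquiv, add_comm]
    have hdist : ∀ (a b : Bool) (x y : Cube d),
        hammingDist (Fin.cons a x : Cube (d + 1)) (Fin.cons b y) =
          (if a = b then 0 else 1) + hammingDist x y := by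
      intro a b x y
      simp only [hammingDist, Finset.card_filter, Fin.sum_univ_succ, Fin.cons_zero, Fin.cons_succ]
      cases a <;> cases b <;> simp
    set M : ℝ := (2 + 2 * Real.cosh t) ^ d with hM
    have hMpos : 0 < M := by have := Real.cosh_pos t; positivity
    have key : ∀ a b : Bool, (∑ x : Cube d, f (Fin.cons a x)) * (∑ x : Cube d, g (Fin.cons b x)) ≤
        (C * Real.exp (t * if a = b then 0 else 1)) * M := by
      intro a b
      refine ih _ (fun x => f (Fin.cons a x)) (fun x => g (Fin.cons b x)) (by positivity)
        (fun _ => hf _) (fun _ => hg _) ?_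
      intro x y
      refine (h _ _).trans (le_of_eq ?_)
      rw [hdist, mul_assoc, ← Real.exp_add]
      cases a <;> cases b <;> simp [mul_add]
    rw [hsplit f, hsplit g]
    have h00 := key false false
    have h11 := key true true
    have h01 := key false true
    have h10 := key true false
    simp only [reduceCtorEq, if_true, if_false, mul_zero, mul_one, Real.exp_zero] at h00 h11 h01 h10
    have hf0 : 0 ≤ ∑ x : Cube d, f (Fin.cons false x) := sum_nonneg fun _ _ => hf _
    have hf1 : 0 ≤ ∑ x : Cube d, f (Fin.cons true x) := sum_nonneg fun _ _ => hf _
    have hg0 : 0 ≤ ∑ x : Cube d, g (Fin.cons false x) := sum_nonneg fun _ _ => hg _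
    have hg1 : 0 ≤ ∑ x : Cube d, g (Fin.cons true x) := sum_nonneg fun _ _ => hg _
    set f0 := ∑ x : Cube d, f (Fin.cons false x)
    set f1 := ∑ x : Cube d, f (Fin.cons true x)
    set g0 := ∑ x : Cube d, g (Fin.cons false x)
    set g1 := ∑ x : Cube d, g (Fin.cons true x)
    have he : 0 < Real.exp t := Real.exp_pos t
    set E := Real.exp t
    have hcosh : 2 * Real.cosh t = E + E⁻¹ := by
      rw [Real.cosh_eq, Real.exp_neg]; ring
    have hD : 0 < C * M := mul_pos hC hMpos
    have hprod : (f0 * g1) * (f1 * g0) ≤ (C * M) * (C * M) := by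
      calc (f0 * g1) * (f1 * g0) = (f0 * g0) * (f1 * g1) := by ring
        _ ≤ (C * M) * (C * M) := mul_le_mul h00 h11 (by positivity) hD.le
    -- With `D = C * M`, both cross terms are at most `D * E` and their product is at most `D²`;
    -- expanding `(D * E - a) * (D * E - b) ≥ 0` bounds their sum.
    have hcross : f0 * g1 + f1 * g0 ≤ C * M * (E + E⁻¹) := by
      refine le_of_mul_le_mul_left ?_ (mul_pos hD he)
      have h1 : C * M * E * (C * M * (E + E⁻¹)) = (C * M * E) ^ 2 + (C * M) * (C * M) := by
        field_simp
      have h2 : 0 ≤ (C * E * M - f0 * g1) * (C * E * M - f1 * g0) :=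
        mul_nonneg (by linarith) (by linarith)
      rw [h1]
      nlinarith
    rw [pow_succ, ← hM, hcosh]
    linarith

/-- The left side is `4 cosh² (t/2)`. -/
theorem two_add_two_mul_cosh_le (t : ℝ) : 2 + 2 * Real.cosh t ≤ 4 * Real.exp (t ^ 2 / 4) := by
  have h := Real.cosh_le_exp_half_sq (t / 2)
  have h1 := Real.cosh_pos (t / 2)
  have h2 : Real.cosh t = 2 * Real.cosh (t / 2) ^ 2 - 1 := by
    have := Real.cosh_two_mul (t / 2)
    have h3 := Real.cosh_sq (t / 2)
    rw [mul_div_cancel₀ _ (two_ne_zero)] at this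
    linarith
  have h3 : Real.exp (t ^ 2 / 4) = Real.exp ((t / 2) ^ 2 / 2) ^ 2 := by
    rw [← Real.exp_nat_mul]; congr 1; push_cast; ring
  rw [h2, h3]
  nlinarith [pow_le_pow_left₀ h1.le h 2]

/-- Concentration: two subsets of the cube at distance more than `r` cannot both be large. -/
theorem card_mul_card_le_of_far {d : ℕ} (A Z : Finset (Cube d)) {r : ℝ} (hr : 0 ≤ r)
    (h : ∀ x ∈ A, ∀ y ∈ Z, r ≤ (hammingDist x y : ℝ)) :
    (A.card : ℝ) * Z.card ≤ 4 ^ d * Real.exp (-(r ^ 2 / d)) := by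
  classical
  -- This `t` minimises the exponent `-t r + d t² / 4`.
  set t : ℝ := 2 * r / d with ht
  have ht0 : 0 ≤ t := by positivity
  have := sum_mul_sum_le_of_mul_le_exp_hammingDist t d (Real.exp (-(t * r)))
    (fun x => if x ∈ A then 1 else 0) (fun x => if x ∈ Z then 1 else 0) (Real.exp_pos _)
    (fun x => by simp only [Pi.zero_apply]; split_ifs <;> norm_num)
    (fun x => by simp only [Pi.zero_apply]; split_ifs <;> norm_num) (by
      intro x y
      rw [← Real.exp_add]
      by_cases hx : x ∈ A
      · by_cases hy : y ∈ Z
        · simp only [hx, hy, if_true, mul_one]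
          refine Real.one_le_exp ?_
          nlinarith [mul_le_mul_of_nonneg_left (h x hx y hy) ht0]
        · simp [hy, Real.exp_nonneg]
      · simp [hx, Real.exp_nonneg])
  simp only [Finset.sum_ite_mem, Finset.univ_inter, Finset.sum_const, nsmul_eq_mul, mul_one] at this
  refine this.trans ?_
  calc Real.exp (-(t * r)) * (2 + 2 * Real.cosh t) ^ d
      ≤ Real.exp (-(t * r)) * (4 * Real.exp (t ^ 2 / 4)) ^ d := by
        have := Real.cosh_pos t
        gcongr
        exact two_add_two_mul_cosh_le t
    _ = 4 ^ d * Real.exp (-(r ^ 2 / d)) := by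
        rw [mul_pow, mul_left_comm, ← Real.exp_nat_mul, ← Real.exp_add]
        congr 2
        rw [ht]
        rcases Nat.eq_zero_or_pos d with rfl | hd
        · simp
        · have : (d : ℝ) ≠ 0 := by positivity
          field_simp
          ring

/-! ### Hamming balls and the size of the far set -/

theorem card_hammingBall {d : ℕ} (q : Cube d) (ρ : ℝ) : (hammingBall q ρ).card = ballSize ρ d := by
  classical
  refine Finset.card_bij' (fun x _ i => xor (x i) (q i)) (fun x _ i => xor (x i) (q i)) ?_ ?_ ?_ ?_
  · intro x hx
    have := hammingDist_comp (fun i (b : Bool) => xor b (q i)) (x := x) (y := q)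
      (fun i a b hab => by simpa using hab)
    simp only [bne_self_eq_false] at this
    simpa [hammingBall, this] using hx
  · intro x hx
    have := hammingDist_comp (fun i (b : Bool) => xor b (q i)) (x := x) (y := fun _ => false)
      (fun i a b hab => by simpa using hab)
    simp only [Bool.false_xor] at this
    simpa [hammingBall, this] using hx
  · intro x _; ext i; simp
  · intro x _; ext i; simp

theorem card_compl_Qfar_le {d : ℕ} (S : Finset (Cube d)) (r c : ℝ) :
    2 ^ d ≤ (Qfar S r c).card + S.card * ballSize (c * r) d := by
  classical
  have h : (Finset.univ : Finset (Cube d)) ⊆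
      Qfar S r c ∪ S.biUnion fun p => hammingBall p (c * r) := by
    intro x _
    by_cases hx : x ∈ Qfar S r c
    · exact Finset.mem_union_left _ hx
    · refine Finset.mem_union_right _ ?_
      simpa [Qfar, hammingBall] using hx
  have h1 := (Finset.card_le_card h).trans (Finset.card_union_le _ _)
  have h2 := Finset.card_biUnion_le_card_mul S (fun p => hammingBall p (c * r))
    (ballSize (c * r) d) (fun p _ => (card_hammingBall p _).le)
  simp only [Finset.card_univ, Fintype.card_pi, Fintype.card_bool, Finset.prod_const,
    Fintype.card_fin] at h1
  omega

/-! ### Counting sets and strings -/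

/-- Compare factor by factor: `(k - i) / (N - i) ≤ k / N`. -/
theorem choose_mul_pow_le {k N : ℕ} (h : k ≤ N) (n : ℕ) :
    k.choose n * N ^ n ≤ N.choose n * k ^ n := by
  have hd : ∀ n, k.descFactorial n * N ^ n ≤ N.descFactorial n * k ^ n := by
    intro n
    induction n with
    | zero => simp
    | succ n ih =>
      have h1 : (k - n) * N ≤ (N - n) * k := by
        rw [Nat.sub_mul, Nat.sub_mul, mul_comm N k]
        exact Nat.sub_le_sub_left (Nat.mul_le_mul_left n h) _
      calc k.descFactorial (n + 1) * N ^ (n + 1)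
          = ((k - n) * N) * (k.descFactorial n * N ^ n) := by
            rw [Nat.descFactorial_succ, pow_succ]; ring
        _ ≤ ((N - n) * k) * (N.descFactorial n * k ^ n) := Nat.mul_le_mul h1 ih
        _ = N.descFactorial (n + 1) * k ^ (n + 1) := by
            rw [Nat.descFactorial_succ, pow_succ]; ring
  have := hd n
  rw [Nat.descFactorial_eq_factorial_mul_choose, Nat.descFactorial_eq_factorial_mul_choose,
    mul_assoc, mul_assoc] at this
  exact Nat.le_of_mul_le_mul_left this n.factorial_pos

theorem card_le_of_length_le (T : Finset (List Bool)) (L : ℕ) (h : ∀ l ∈ T, l.length ≤ L) :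
    T.card ≤ 2 ^ (L + 1) := by
  let φ : T → Σ k : Fin (L + 1), List.Vector Bool k := fun l =>
    ⟨⟨l.1.length, Nat.lt_succ_of_le (h _ l.2)⟩, ⟨l.1, rfl⟩⟩
  let ψ : (Σ k : Fin (L + 1), List.Vector Bool k) → List Bool := fun v => v.2.1
  have hφ : Function.Injective φ := by
    intro a b hab
    exact Subtype.ext (congrArg ψ hab)
  have h1 := Fintype.card_le_of_injective φ hφ
  simp only [Fintype.card_coe, Fintype.card_sigma, card_vector, Fintype.card_bool] at h1
  rw [Fin.sum_univ_eq_sum_range (fun k => 2 ^ k)] at h1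
  exact h1.trans (Nat.geomSum_lt le_rfl fun k hk => Finset.mem_range.1 hk).le

/-- A family of `n`-sets that is covered by few small sets is small. -/
theorem card_le_of_encode {α : Type*} [Fintype α] [Nonempty α] [DecidableEq α] (n L : ℕ)
    (θ : ℝ) (hθ0 : 0 ≤ θ)
    (G : Finset (Finset α)) (hG : ∀ S ∈ G, S.card = n) (e : Finset α → List Bool)
    (hL : ∀ S ∈ G, (e S).length ≤ L) (I : List Bool → Finset α)
    (hI : ∀ S ∈ G, S ⊆ I (e S)) (hθ : ∀ S ∈ G, ((I (e S)).card : ℝ) ≤ θ * Fintype.card α) :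
    (G.card : ℝ) ≤ 2 ^ (L + 1) * (θ ^ n * (Fintype.card α).choose n) := by
  have hN : (0 : ℝ) < Fintype.card α := by exact_mod_cast Fintype.card_pos
  have hfib : ∀ m ∈ G.image e, ((G.filter fun S => e S = m).card : ℝ) ≤
      θ ^ n * (Fintype.card α).choose n := by
    intro m hm
    obtain ⟨S, hS, rfl⟩ := Finset.mem_image.1 hm
    -- Sets sharing a string are all `n`-subsets of the same small set.
    have hsub : (G.filter fun T => e T = e S) ⊆ Finset.powersetCard n (I (e S)) := by
      intro T hT
      obtain ⟨hT, hTe⟩ := Finset.mem_filter.1 hT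
      exact Finset.mem_powersetCard.2 ⟨hTe ▸ hI T hT, hG T hT⟩
    have h1 := Finset.card_le_card hsub
    rw [Finset.card_powersetCard] at h1
    have h2 := choose_mul_pow_le (Finset.card_le_univ (I (e S))) n
    have h3 : ((I (e S)).card.choose n : ℝ) * (Fintype.card α : ℝ) ^ n ≤
        (Fintype.card α).choose n * ((I (e S)).card : ℝ) ^ n := by exact_mod_cast h2
    have h4 : ((I (e S)).card : ℝ) ^ n ≤ (θ * Fintype.card α) ^ n :=
      pow_le_pow_left₀ (Nat.cast_nonneg _) (hθ S hS) n
    have h5 : ((I (e S)).card.choose n : ℝ) ≤ θ ^ n * (Fintype.card α).choose n := by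
      refine le_of_mul_le_mul_right (h3.trans ?_) (pow_pos hN n)
      refine (mul_le_mul_of_nonneg_left h4 (Nat.cast_nonneg _)).trans (le_of_eq ?_)
      rw [mul_pow]; ring
    exact (Nat.cast_le.2 h1).trans h5
  have hcard : (G.card : ℝ) = ∑ m ∈ G.image e, ((G.filter fun S => e S = m).card : ℝ) := by
    exact_mod_cast Finset.card_eq_sum_card_image e G
  rw [hcard]
  refine (Finset.sum_le_card_nsmul _ _ _ hfib).trans ?_
  rw [nsmul_eq_mul]
  have := card_le_of_length_le (G.image e) L (by
    intro l hl
    obtain ⟨S, hS, rfl⟩ := Finset.mem_image.1 hl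
    exact hL S hS)
  have h6 : ((G.image e).card : ℝ) ≤ 2 ^ (L + 1) := by exact_mod_cast this
  gcongr

/-! ### Fixing the random choices -/

/-- Averaging over the random choices, then Markov's inequality. -/
theorem exists_half_good {Ω ι : Type*} [MeasurableSpace Ω] (μ : Measure Ω) [IsProbabilityMeasure μ]
    (P : Finset ι) (h : ι → Ω → ℝ) (ε : ℝ) (hε : 0 < ε) (hint : ∀ S ∈ P, Integrable (h S) μ)
    (h1 : ∀ S ∈ P, ∀ ω, h S ω ≤ 1) (hmean : ∀ S ∈ P, 1 - ε ≤ ∫ ω, h S ω ∂μ) :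
    ∃ ω, ∃ G ⊆ P, (P.card : ℝ) ≤ 2 * G.card ∧ ∀ S ∈ G, 1 - 2 * ε ≤ h S ω := by
  classical
  obtain ⟨ω, hω⟩ := exists_integral_le (μ := μ) (f := fun ω => ∑ S ∈ P, h S ω)
    (integrable_finsetSum _ hint)
  rw [integral_finsetSum _ hint] at hω
  have hlow := Finset.card_nsmul_le_sum P _ _ hmean
  rw [nsmul_eq_mul] at hlow
  refine ⟨ω, P.filter fun S => 1 - 2 * ε ≤ h S ω, Finset.filter_subset _ _, ?_,
    fun S hS => (Finset.mem_filter.1 hS).2⟩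
  have hsum : ∑ S ∈ P, h S ω ≤ ∑ S ∈ P, (1 - 2 * ε + if 1 - 2 * ε ≤ h S ω then 2 * ε else 0) := by
    refine Finset.sum_le_sum fun S hS => ?_
    split_ifs with hh
    · linarith [h1 S hS ω]
    · linarith
  rw [Finset.sum_add_distrib, ← Finset.sum_filter, Finset.sum_const, Finset.sum_const,
    nsmul_eq_mul, nsmul_eq_mul] at hsum
  have := hlow.trans (hω.trans hsum)
  nlinarith

/-! ### The space lower bound -/

theorem theorem2 :
    ∃ K : ℝ, 0 < K ∧
      ∀ (d n : ℕ) (r c ε : ℝ), 0 ≤ r → 1 ≤ c →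
        (n : ℝ) * (ballSize (c * r) d : ℝ) / 2 ^ d < ε → ε < 1 / 4 →
        ∀ (Ω : Type*) [MeasurableSpace Ω] (μ : Measure Ω) [IsProbabilityMeasure μ]
          (F : MembershipFilter d Ω),
          (∀ S : Finset (Cube d), S.card = n → F.HasAverageError μ r c ε S) →
          ∃ S : Finset (Cube d), S.card = n ∧ ∃ ω : Ω,
            K * ((n : ℝ) * (r ^ 2 / (d : ℝ) + Real.logb 2 (1 / ε))) ≤
              ((F.encode S ω).length : ℝ) := by
  classical
  -- At the end `n * (X - l) ≤ 11 * (L + 2)`, and `L + 2 ≤ 3 * L` since `L ≥ 1`.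
  refine ⟨1 / 33, by norm_num, ?_⟩
  intro d n r c ε hr hc hlow hε Ω _ μ _ F hF
  rcases Nat.eq_zero_or_pos n with rfl | hn
  · have : Nonempty Ω := nonempty_of_isProbabilityMeasure μ
    exact ⟨∅, rfl, Classical.arbitrary Ω, by simp⟩
  have hε0 : 0 < ε := lt_of_le_of_lt (by positivity) hlow
  have hN : (0 : ℝ) < 2 ^ d := by positivity
  have hcube : Fintype.card (Cube d) = 2 ^ d := by simp
  have hfar : ∀ S : Finset (Cube d), S.card = n → (1 - ε) * 2 ^ d < (Qfar S r c).card := by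
    intro S hS
    have h1 := card_compl_Qfar_le S r c
    rw [hS] at h1
    have h2 : (2 : ℝ) ^ d ≤ (Qfar S r c).card + n * ballSize (c * r) d := by exact_mod_cast h1
    have h3 := (div_lt_iff₀ hN).1 hlow
    linarith
  have hfarpos : ∀ S : Finset (Cube d), S.card = n → (0 : ℝ) < (Qfar S r c).card := fun S hS =>
    lt_of_le_of_lt (mul_nonneg (by linarith) hN.le) (hfar S hS)
  have hball : 1 ≤ ballSize (c * r) d := by
    refine Finset.card_pos.2 ⟨fun _ => false, ?_⟩
    have : 0 ≤ c * r := by positivity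
    simpa [hammingBall] using this
  have hnN : n ≤ 2 ^ d := by
    have h3 := (div_lt_iff₀ hN).1 hlow
    have h4 : (1 : ℝ) ≤ ballSize (c * r) d := by exact_mod_cast hball
    have h5 : (n : ℝ) ≤ 2 ^ d := by nlinarith [(Nat.cast_nonneg n : (0 : ℝ) ≤ n)]
    exact_mod_cast h5
  set P : Finset (Finset (Cube d)) := Finset.powersetCard n Finset.univ with hP
  have memP : ∀ S, S ∈ P ↔ S.card = n := fun S => by simp [hP, Finset.mem_powersetCard]
  have hPcard : P.card = (Fintype.card (Cube d)).choose n := by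
    rw [hP, Finset.card_powersetCard, Finset.card_univ]
  have hPpos : (0 : ℝ) < P.card := by
    rw [hPcard, hcube]; exact_mod_cast Nat.choose_pos hnN
  obtain ⟨ω, G, hGP, hGcard, hG⟩ := exists_half_good μ P
    (fun S ω => (∑ q ∈ Qfar S r c, Set.indicator {ω | F.answer S ω q = false} (fun _ => (1 : ℝ)) ω) /
      ((Qfar S r c).card : ℝ)) ε hε0
    (fun S hS => (integrable_finsetSum _ fun q _ => (integrable_const (1 : ℝ)).indicator
      ((hF S ((memP S).1 hS)).measurableSet_no q)).div_const _)
    (fun S hS ω => by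
      rw [div_le_one (hfarpos S ((memP S).1 hS))]
      refine (Finset.sum_le_card_nsmul _ _ 1 fun q _ => ?_).trans (by simp)
      exact Set.indicator_le_self' (fun _ _ => zero_le_one) ω)
    (fun S hS => by
      have hS' := (memP S).1 hS
      rw [integral_div, integral_finsetSum _ fun q _ => (integrable_const (1 : ℝ)).indicator
        ((hF S hS').measurableSet_no q)]
      have hone : ∀ q, ∫ ω, Set.indicator {ω | F.answer S ω q = false} (fun _ => (1 : ℝ)) ω ∂μ =
          μ.real {ω | F.answer S ω q = false} := fun q =>
        integral_indicator_one ((hF S hS').measurableSet_no q)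
      simp_rw [hone]
      exact (hF S hS').no_of_far (Finset.card_pos.1 (by exact_mod_cast hfarpos S hS')))
  set Z : List Bool → Finset (Cube d) := fun m => Finset.univ.filter fun q => F.query m ω q = false
    with hZ
  set A : List Bool → Finset (Cube d) := fun m =>
    Finset.univ.filter fun x => ∀ y ∈ Z m, r < (hammingDist x y : ℝ) with hA
  have hZcard : ∀ S ∈ G, (1 - 3 * ε) * 2 ^ d ≤ ((Z (F.encode S ω)).card : ℝ) := by
    intro S hS
    have hS' := (memP S).1 (hGP hS)
    have h1 := hG S hS
    rw [le_div_iff₀ (hfarpos S hS')] at h1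
    have h2 : ∑ q ∈ Qfar S r c, Set.indicator {ω | F.answer S ω q = false} (fun _ => (1 : ℝ)) ω ≤
        (Z (F.encode S ω)).card := by
      simp only [Set.indicator_apply, Set.mem_ofPred_eq, MembershipFilter.answer]
      rw [← Finset.sum_filter, Finset.sum_const, nsmul_eq_mul, mul_one]
      exact_mod_cast Finset.card_le_card (Finset.filter_subset_filter _ (Finset.subset_univ _))
    have h3 := hfar S hS'
    have h4 : (1 - 2 * ε) * ((1 - ε) * 2 ^ d) ≤ (1 - 2 * ε) * (Qfar S r c).card :=
      mul_le_mul_of_nonneg_left h3.le (by linarith)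
    have h5 : 0 ≤ ε ^ 2 * 2 ^ d := by positivity
    nlinarith
  have hSA : ∀ S ∈ G, S ⊆ A (F.encode S ω) := by
    intro S hS x hx
    simp only [hA, Finset.mem_filter, Finset.mem_univ, true_and]
    intro y hy
    by_contra! hxy
    have hyes := (hF S ((memP S).1 (hGP hS))).yes_of_near y (by
      simp only [Qnear, Finset.mem_filter, Finset.mem_univ, true_and]
      exact ⟨x, hx, by rwa [hammingDist_comm]⟩) ω
    simp only [hZ, Finset.mem_filter, Finset.mem_univ, true_and] at hy
    simp [MembershipFilter.answer, hy] at hyes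
  have hA1 : ∀ S ∈ G, ((A (F.encode S ω)).card : ℝ) ≤ 3 * ε * Fintype.card (Cube d) := by
    intro S hS
    have hdisj : Disjoint (A (F.encode S ω)) (Z (F.encode S ω)) := by
      rw [Finset.disjoint_left]
      intro x hx hxZ
      have := (Finset.mem_filter.1 hx).2 x hxZ
      rw [hammingDist_self, Nat.cast_zero] at this
      exact this.not_ge hr
    have h1 := Finset.card_le_univ (A (F.encode S ω) ∪ Z (F.encode S ω))
    rw [Finset.card_union_of_disjoint hdisj, hcube] at h1
    have h2 : ((A (F.encode S ω)).card : ℝ) + (Z (F.encode S ω)).card ≤ 2 ^ d := by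
      exact_mod_cast h1
    rw [hcube]
    push_cast
    linarith [hZcard S hS]
  have hA2 : ∀ S ∈ G, ((A (F.encode S ω)).card : ℝ) ≤
      4 * Real.exp (-(r ^ 2 / d)) * Fintype.card (Cube d) := by
    intro S hS
    have h1 := card_mul_card_le_of_far (A (F.encode S ω)) (Z (F.encode S ω)) hr
      (fun x hx y hy => ((Finset.mem_filter.1 hx).2 y hy).le)
    have h2 : 1 / 4 * 2 ^ d ≤ ((Z (F.encode S ω)).card : ℝ) :=
      (mul_le_mul_of_nonneg_right (by linarith) hN.le).trans (hZcard S hS)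
    rw [hcube]
    push_cast
    have h3 := (mul_le_mul_of_nonneg_left h2 (Nat.cast_nonneg (A (F.encode S ω)).card)).trans h1
    have h4 : (4 : ℝ) ^ d = 2 ^ d * 2 ^ d := by rw [← mul_pow]; norm_num
    rw [h4] at h3
    refine le_of_mul_le_mul_right ?_ hN
    linarith
  have hGpos : (0 : ℝ) < G.card := by linarith
  obtain ⟨S₁, hS₁⟩ : G.Nonempty := Finset.card_pos.1 (by exact_mod_cast hGpos)
  obtain ⟨S, hSP, hmax⟩ := Finset.exists_max_image P (fun S => (F.encode S ω).length)
    ⟨S₁, hGP hS₁⟩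
  refine ⟨S, (memP S).1 hSP, ω, ?_⟩
  set L := (F.encode S ω).length with hL
  -- Needed to absorb the additive 2 lost in counting. If every string were empty, all sets would
  -- share one nonempty No-set, yet some `n`-set contains a point of it.
  have hL1 : 1 ≤ L := by
    by_contra! hL0
    have hnil : ∀ T ∈ P, F.encode T ω = [] := fun T hT =>
      List.length_eq_zero_iff.1 (by have := hmax T hT; omega)
    have h1 := hZcard S₁ hS₁
    have hpos : (0 : ℝ) < (Z (F.encode S₁ ω)).card :=
      lt_of_lt_of_le (mul_pos (by linarith) hN) h1
    obtain ⟨y, hy⟩ := Finset.card_pos.1 (by exact_mod_cast hpos)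
    obtain ⟨T, hyT, -, hT⟩ := Finset.exists_subsuperset_card_eq
      (Finset.subset_univ ({y} : Finset (Cube d))) (n := n) (by rw [Finset.card_singleton]; exact hn)
      (by rw [Finset.card_univ, hcube]; exact hnN)
    have hyes := (hF T hT).yes_of_near y (by
      simp only [Qnear, Finset.mem_filter, Finset.mem_univ, true_and]
      exact ⟨y, Finset.singleton_subset_iff.1 hyT, by simpa using hr⟩) ω
    have hno := (Finset.mem_filter.1 hy).2
    rw [hnil S₁ (hGP hS₁)] at hno
    simp [MembershipFilter.answer, hnil T ((memP T).2 hT), hno] at hyes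
  have hcount : ∀ θ : ℝ, 0 < θ →
      (∀ S ∈ G, ((A (F.encode S ω)).card : ℝ) ≤ θ * Fintype.card (Cube d)) →
      0 ≤ (L : ℝ) + 2 + n * Real.logb 2 θ := by
    intro θ hθ hbound
    have h1 := card_le_of_encode n L θ hθ.le G (fun S hS => (memP S).1 (hGP hS))
      (fun S => F.encode S ω) (fun S hS => hmax S (hGP hS)) A hSA hbound
    rw [← hPcard] at h1
    have h2 : 1 * (P.card : ℝ) ≤ (2 ^ (L + 2) * θ ^ n) * P.card := by
      rw [pow_succ 2 (L + 1)]
      linarith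
    have h3 := le_of_mul_le_mul_right h2 hPpos
    have h4 := Real.logb_nonneg (b := 2) (by norm_num) h3
    rw [Real.logb_mul (by positivity) (by positivity), Real.logb_pow, Real.logb_pow,
      Real.logb_self_eq_one (by norm_num)] at h4
    push_cast at h4
    linarith
  have hc1 := hcount (3 * ε) (by positivity) hA1
  have hc2 := hcount (4 * Real.exp (-(r ^ 2 / d))) (by positivity) hA2
  set X := r ^ 2 / (d : ℝ) with hX
  have hX0 : 0 ≤ X := by positivity
  rw [Real.logb_mul (by norm_num) hε0.ne'] at hc1
  rw [Real.logb_mul (by norm_num) (Real.exp_pos _).ne'] at hc2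
  have hlog4 : Real.logb 2 4 = 2 := by
    rw [show (4 : ℝ) = 2 ^ 2 by norm_num, Real.logb_pow, Real.logb_self_eq_one (by norm_num)]
    norm_num
  -- This is `3 ^ 5 = 243 ≤ 256 = 2 ^ 8`.
  have hlog3 : Real.logb 2 3 ≤ 8 / 5 := by
    rw [Real.logb_le_iff_le_rpow (by norm_num) (by norm_num)]
    refine le_of_pow_le_pow_left₀ (n := 5) (by norm_num) (by positivity) ?_
    rw [← Real.rpow_natCast, ← Real.rpow_natCast, ← Real.rpow_mul (by norm_num)]
    norm_num
  have hlogexp : Real.logb 2 (Real.exp (-X)) ≤ -X := by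
    rw [Real.logb, Real.log_exp, div_le_iff₀ (Real.log_pos (by norm_num))]
    have : Real.log 2 ≤ 1 := by linarith [Real.log_two_lt_d9]
    nlinarith
  have hlogε : Real.logb 2 ε ≤ -2 := by
    have h1 := Real.logb_le_logb_of_le (b := 2) (by norm_num) hε0 hε.le
    rw [one_div, Real.logb_inv, hlog4] at h1
    exact h1
  rw [one_div ε, Real.logb_inv]
  set l := Real.logb 2 ε
  have hn0 : (0 : ℝ) < n := by exact_mod_cast hn
  have hL1' : (1 : ℝ) ≤ L := by exact_mod_cast hL1
  -- Since `l ≤ -2`, the constants `log 3` and `log 4` are absorbed into `l`. Then `e1` gives `-n *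
  -- l ≤ 5 * (L + 2)`, and `e2` gives `n * X ≤ (L + 2) - n * l ≤ 6 * (L + 2)`.
  have e1 : n * (Real.logb 2 3 + l) ≤ n * (1 / 5 * l) :=
    mul_le_mul_of_nonneg_left (by linarith) hn0.le
  have e2 : n * (Real.logb 2 4 + Real.logb 2 (Real.exp (-X))) ≤ n * (-l - X) :=
    mul_le_mul_of_nonneg_left (by linarith) hn0.le
  nlinarith
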